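/- **Notation.** Let $p\ge 0$, let $t,n_1,\dots,n_p\ge 1$ be integers, let $1\le k\le t$, and put $n=n_1\cdots n_p$ ($n=1$ if $p=0$). For $\mathcal Z\in\mathbb R^{a\times b\times n_1\times\cdots\times n_p}$ let $\mathcal Z_{\mathcal F}$ be its (unnormalised) discrete Fourier transform along the last $p$ modes, and call the $a\times b$ matrices $\mathcal Z(:,:,i_1,\dots,i_p)$ its face slices. * The t-product $\mathcal A*\mathcal B$ of an $a\times b\times n_1\times\cdots\times n_p$ and a $b\times c\times n_1\times\cdots\times n_p$ tensor is the matrix product in which products of entries are replaced by circular convolutions of tubes, $(\mathcal A*\mathcal B)(i,l,:,\dots,:)=\sum_j\mathcal A(i,j,:,\dots,:)\star\mathcal B(j,l,:,\dots,:)$. The transpose $\mathcal Z^{\mathrm T}$ is the tensor for which each face slice of $(\mathcal Z^{\mathrm T})_{\mathcal F}$ is the conjugate transpose of the corresponding face slice of $\mathcal Z_{\mathcal F}$, and $\mathcal I_a$ is the $a\times a\times n_1\times\cdots\times n_p$ tensor for which all face slices of $(\mathcal I_a)_{\mathcal F}$ are the identity matrix. A tensor $\mathcal U$ is orthogonal if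 $\mathcal U^{\mathrm T}*\mathcal U=\mathcal U*\mathcal U^{\mathrm T}=\mathcal I$. A tensor is f-diagonal if all its face slices are diagonal. * A t-SVD of $\mathcal Z$ is a factorization $\mathcal Z=\mathcal U*\mathcal S*\mathcal V^{\mathrm T}$ into real tensors with $\mathcal U,\mathcal V$ orthogonal and $\mathcal S$ f-diagonal, where each face slice of $\mathcal S_{\mathcal F}$ has a nonnegative nonincreasing diagonal. The t-SVD rank of $\mathcal Z$ is $\#\{i:\mathcal S(i,i,:,\dots,:)\ne 0\}$. If it equals $r$, a skinny t-SVD of $\mathcal Z\in\mathbb R^{a\times b\times n_1\times\cdots\times n_p}$ is a factorization $\mathcal Z=\mathcal U*\mathcal S*\mathcal V^{\mathrm T}$ with $\mathcal U\in\mathbb R^{a\times r\times n_1\times\cdots\times n_p}$, $\mathcal V\in\mathbb R^{b\times r\times n_1\times\cdots\times n_p}$, $\mathcal U^{\mathrm T}*\mathcal U=\mathcal V^{\mathrm T}*\mathcal V=\mathcal I_r$, and $\mathcal S\in\mathbb R^{r\times r\times n_1\times\cdots\times n_p}$ of the same kind as above. The multi-rank sum of $\mathcal Z$ is the sum of the ranks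 of the $n$ face slices of $\mathcal Z_{\mathcal F}$. The tensor nuclear norm is $\|\mathcal Z\|_{\circledast}=\frac1n\|\operatorname{bdiag}(\mathcal Z_{\mathcal F})\|_*$, where $\operatorname{bdiag}(\mathcal Z_{\mathcal F})$ is the block diagonal matrix whose blocks are the face slices of $\mathcal Z_{\mathcal F}$ and $\|\cdot\|_*$ is the matrix nuclear norm. * For $\mathcal X\in\mathbb R^{t\times n_1\times\cdots\times n_p}$ the temporal Hankel tensor $\mathcal H_k(\mathcal X)\in\mathbb R^{t\times k\times n_1\times\cdots\times n_p}$ is $\mathcal H_k(\mathcal X)(i,j,i_1,\dots,i_p)=\frac1{\sqrt k}\,\mathcal X(i+j-1,i_1,\dots,i_p)$, the time index being taken modulo $t$ in $\{1,\dots,t\}$. * For $\Omega\subseteq[t]\times[n_1]\times\cdots\times[n_p]$, $\mathcal P_\Omega$ keeps the entries in $\Omega$ and sets the others to $0$, and $\rho(\Omega)=\min_{i_1,\dots,i_p}\frac1t\#\{i:(i,i_1,\dots,i_p)\in\Omega\}$ is the minimum temporal sampling rate. * $\mathcal M\in\mathbb R^{t\times n_1\times\cdots\times n_p}$ satisfies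 the temporal Hankel tensor incoherence conditions with scale factor $k$ and parameter $\mu>0$ if, with $r$ the t-SVD rank of $\mathcal H_k(\mathcal M)$, there is a skinny t-SVD $\mathcal H_k(\mathcal M)=\mathcal U*\mathcal S*\mathcal V^{\mathrm T}$ such that $$\max_{1\le i\le t}\|\mathcal U^{\mathrm T}*\mathring{\mathfrak e}_t^{(i)}\|_F\le\sqrt{\frac{\mu r}{tn}},\qquad \max_{1\le i\le k}\|\mathcal V^{\mathrm T}*\mathring{\mathfrak e}_k^{(i)}\|_F\le\sqrt{\frac{\mu r}{kn}},$$ where $\mathring{\mathfrak e}_a^{(i)}\in\mathbb R^{a\times1\times n_1\times\cdots\times n_p}$ has $(i,1,1,\dots,1)$-th entry $1$ and all other entries $0$. **Theorem.** Let $\mathcal M\in\mathbb R^{t\times n_1\times\cdots\times n_p}$ satisfy the temporal Hankel tensor incoherence conditions with scale factor $k$ and parameter $\mu$. Let $r$ be the t-SVD rank and $r_s$ the multi-rank sum of $\mathcal H_k(\mathcal M)$. Let $\alpha\in(0,1)$ and let $\Omega\subseteq[t]\times[n_1]\times\cdots\times[n_p]$ satisfy $$\rho(\Omega)>1-\frac{\alpha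 k}{2\mu r(r_s+1)t}$$ (if $r=0$, the fraction is read as $+\infty$ and this is no condition). Let $\delta\in\mathbb R$ and let $\mathcal Y\in\mathbb R^{t\times n_1\times\cdots\times n_p}$ satisfy $\|\mathcal P_\Omega(\mathcal M-\mathcal Y)\|_F\le\delta$. Then every solution $\hat{\mathcal M}$ of the noisy LRTC-TIDT model $$\min_{\mathcal X\in\mathbb R^{t\times n_1\times\cdots\times n_p}}\|\mathcal H_k(\mathcal X)\|_{\circledast}\quad\text{s.t.}\quad\|\mathcal P_\Omega(\mathcal X-\mathcal Y)\|_F\le\delta$$ obeys $$\|\hat{\mathcal M}-\mathcal M\|_F\le\left(2\,\frac{\sqrt{r_s+1-\alpha}+\sqrt{r_s+1}}{\sqrt{r_s+1-\alpha}-\sqrt{\alpha r_s}}\,\sqrt{nt}+2\right)\delta.$$ -/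

import Mathlib

namespace TIDT

/-- The index set `[n₁] × ⋯ × [n_p]` of the last `p` modes. Each `[n_j]` is identified with
`ℤ/n_j` (its elements counted from `0`), the group underlying circular convolution and the DFT. -/
abbrev Modes {p : ℕ} (n : Fin p → ℕ) : Type := (j : Fin p) → ZMod (n j)

/-- A real `t × n₁ × ⋯ × n_p` tensor; the first mode is time. -/
abbrev TimeSeries {p : ℕ} (t : ℕ) (n : Fin p → ℕ) : Type := Fin t → Modes n → ℝ

/-- An `a × b × n₁ × ⋯ × n_p` tensor over `R`, given by its face slices:
the `(i, j, i₁, …, i_p)` entry of `Z` is `Z (i₁, …, i_p) i j`. -/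
abbrev Tensor {p : ℕ} (a b : ℕ) (n : Fin p → ℕ) (R : Type) : Type :=
  Modes n → Matrix (Fin a) (Fin b) R

section Algebra

variable {p : ℕ} {n : Fin p → ℕ} [∀ j, NeZero (n j)]

/-- Frobenius norm of a time series tensor. -/
noncomputable def frobSeries {t : ℕ} (X : TimeSeries t n) : ℝ :=
  √(∑ i, ∑ ν, X i ν ^ 2)

/-- Frobenius norm of an order-`(p+2)` tensor. -/
noncomputable def frobTensor {a b : ℕ} (Z : Tensor a b n ℝ) : ℝ :=
  √(∑ ν, ∑ i, ∑ j, Z ν i j ^ 2)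

/-- The (unnormalised) discrete Fourier transform along the last `p` modes;
`ZMod.stdAddChar x = exp (2πi x / N)` for `x : ZMod N`. -/
noncomputable def dft {a b : ℕ} (Z : Tensor a b n ℝ) : Tensor a b n ℂ := fun ξ =>
  ∑ ν : Modes n, (∏ j, ZMod.stdAddChar (-(ν j * ξ j))) • (Z ν).map Complex.ofReal

/-- The t-product: the matrix product in which products of entries are replaced by the circular
convolution of the corresponding tubes. -/
noncomputable def tProd {a b c : ℕ} (A : Tensor a b n ℝ) (B : Tensor b c n ℝ) :
    Tensor a c n ℝ := fun ν =>
  Matrix.of fun i l => ∑ j, ∑ κ : Modes n, A κ i j * B (ν - κ) j l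

/-- The tensor transpose; in the Fourier domain it is the conjugate transpose of every face slice
(see `dft_tTranspose`). -/
def tTranspose {a b : ℕ} (Z : Tensor a b n ℝ) : Tensor b a n ℝ := fun ν => (Z (-ν)).transpose

/-- The identity tensor: the unit of the t-product, all of whose Fourier-domain face slices are
the identity matrix (see `dft_tIdentity`). -/
def tIdentity (a : ℕ) : Tensor a a n ℝ := fun ν => if ν = 0 then 1 else 0

theorem dft_tTranspose {a b : ℕ} (Z : Tensor a b n ℝ) (ξ : Modes n) :
    dft (tTranspose Z) ξ = (dft Z ξ).conjTranspose := by
  unfold dft tTranspose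
  rw [Matrix.conjTranspose_sum, ← Equiv.sum_comp (Equiv.neg (Modes n))]
  refine Finset.sum_congr rfl fun ν _ => ?_
  ext i j
  have h : ∀ l, (starRingEnd ℂ) (ZMod.stdAddChar (-(ν l * ξ l))) =
      ZMod.stdAddChar (ν l * ξ l) := fun l => by
    rw [← AddChar.map_neg_eq_conj, neg_neg]
  simp [h]

theorem dft_tIdentity (a : ℕ) (ξ : Modes n) : dft (tIdentity a : Tensor a a n ℝ) ξ = 1 := by
  unfold dft tIdentity
  rw [Finset.sum_eq_single 0]
  · ext i j
    simp [Matrix.one_apply]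
  · intro ν _ hν
    simp [hν]
  · simp

/-- Orthogonal tensor. -/
def IsOrthogonal {a : ℕ} (U : Tensor a a n ℝ) : Prop :=
  tProd (tTranspose U) U = tIdentity a ∧ tProd U (tTranspose U) = tIdentity a

/-- All face slices are diagonal. -/
def IsFDiagonal {a b : ℕ} (S : Tensor a b n ℝ) : Prop :=
  ∀ ν (i : Fin a) (j : Fin b), (i : ℕ) ≠ j → S ν i j = 0

/-- `S` is f-diagonal and the diagonal of each of its Fourier-domain face slices is real,
nonnegative and nonincreasing, i.e. it lists singular values in the usual order. This is the
usual normalisation in a t-SVD, without which the t-SVD rank would not be well defined. -/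
def IsSingularTensor {a b : ℕ} (S : Tensor a b n ℝ) : Prop :=
  IsFDiagonal S ∧
  (∀ ξ (i : Fin a) (j : Fin b), (i : ℕ) = j → 0 ≤ (dft S ξ i j).re ∧ (dft S ξ i j).im = 0) ∧
  ∀ ξ (i i' : Fin a) (j j' : Fin b), (i : ℕ) = j → (i' : ℕ) = j' → i ≤ i' →
    (dft S ξ i' j').re ≤ (dft S ξ i j).re

/-- `Z = U * S * Vᵀ` is a (full) t-SVD of `Z`. -/
def IsTSVD {a b : ℕ} (Z : Tensor a b n ℝ) (U : Tensor a a n ℝ) (S : Tensor a b n ℝ)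
    (V : Tensor b b n ℝ) : Prop :=
  IsOrthogonal U ∧ IsOrthogonal V ∧ IsSingularTensor S ∧
    Z = tProd (tProd U S) (tTranspose V)

/-- The number of indices `i` for which the diagonal tube `S(i, i, :, …, :)` is nonzero. -/
noncomputable def numNonzeroTubes {a b : ℕ} (S : Tensor a b n ℝ) : ℕ :=
  Set.ncard {i : ℕ | ∃ (ha : i < a) (hb : i < b), ∃ ν, S ν ⟨i, ha⟩ ⟨i, hb⟩ ≠ 0}

/-- The t-SVD rank: the number of nonzero diagonal tubes of `S` in a t-SVD `Z = U * S * Vᵀ`.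
(`S` is determined by `Z`, so the set below has a single element.) -/
noncomputable def tSVDRank {a b : ℕ} (Z : Tensor a b n ℝ) : ℕ :=
  sInf {r | ∃ U S V, IsTSVD Z U S V ∧ numNonzeroTubes S = r}

/-- `Z = U * S * Vᵀ` is a skinny t-SVD of `Z`: only the first `r` lateral slices of the orthogonal
tensors are kept, where `r` is the t-SVD rank. -/
def IsSkinnyTSVD {a b : ℕ} (Z : Tensor a b n ℝ) (U : Tensor a (tSVDRank Z) n ℝ)
    (S : Tensor (tSVDRank Z) (tSVDRank Z) n ℝ) (V : Tensor b (tSVDRank Z) n ℝ) : Prop :=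
  tProd (tTranspose U) U = tIdentity (tSVDRank Z) ∧
  tProd (tTranspose V) V = tIdentity (tSVDRank Z) ∧
  IsSingularTensor S ∧
  Z = tProd (tProd U S) (tTranspose V)

/-- The multi-rank sum `r_s`: the sum of the ranks of the Fourier-domain face slices. -/
noncomputable def multiRankSum {a b : ℕ} (Z : Tensor a b n ℝ) : ℕ :=
  ∑ ξ : Modes n, (dft Z ξ).rank

/-- The nuclear norm of a complex matrix: the sum of its singular values. (`singularValues` is an
infinite sequence that vanishes from index `Fintype.card l` on.) -/
noncomputable def nuclearNorm {m l : Type} [Fintype m] [Fintype l] [DecidableEq m] [DecidableEq l]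
    (A : Matrix m l ℂ) : ℝ :=
  ∑ i ∈ Finset.range (Fintype.card l), (Matrix.toEuclideanLin A).singularValues i

/-- The tensor nuclear norm `(1 / (n₁ ⋯ n_p)) ‖bdiag(Z_F)‖_*`. -/
noncomputable def tnn {a b : ℕ} (Z : Tensor a b n ℝ) : ℝ :=
  (1 / ((∏ j, n j : ℕ) : ℝ)) * nuclearNorm (Matrix.blockDiagonal (dft Z))

end Algebra

section Model

variable {p : ℕ} {n : Fin p → ℕ} [∀ j, NeZero (n j)] {t : ℕ}

/-- The temporal isometric delay-embedding (temporal Hankel) transform: the `(i, j)` block is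
`M_{i+j}` with cyclic time index (counted from `0`), scaled by `1/√k`. -/
noncomputable def hankel (k : ℕ) (M : TimeSeries t n) : Tensor t k n ℝ := fun ν =>
  Matrix.of fun i j => (1 / √(k : ℝ)) * M ⟨((i : ℕ) + (j : ℕ)) % t, Nat.mod_lt _ i.pos⟩ ν

/-- The sampling operator `P_Ω`: keep the entries in `Ω`, replace the others by `0`. -/
def sample (Ω : Finset (Fin t × Modes n)) (X : TimeSeries t n) : TimeSeries t n :=
  fun i ν => if (i, ν) ∈ Ω then X i ν else 0

/-- The temporal sampling number of the time series vector with index `ν = (i₁, …, i_p)`. -/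
def samplingNumber (Ω : Finset (Fin t × Modes n)) (ν : Modes n) : ℕ :=
  (Finset.univ.filter fun i : Fin t => (i, ν) ∈ Ω).card

/-- The minimum temporal sampling rate `ρ(Ω)`. -/
noncomputable def minSamplingRate (Ω : Finset (Fin t × Modes n)) : ℝ :=
  Finset.univ.inf' Finset.univ_nonempty fun ν : Modes n => (samplingNumber Ω ν : ℝ) / (t : ℝ)

/-- The column basis tensor of size `a × 1 × n₁ × ⋯ × n_p`: its `(i, 1, 1, …, 1)` entry is `1` and
all other entries are `0`. (The first index of each of the last `p` modes is `0 : ZMod (n j)`.) -/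
def colBasis {a : ℕ} (i : Fin a) : Tensor a 1 n ℝ := fun ν =>
  Matrix.of fun i' _ => if i' = i ∧ ν = 0 then 1 else 0

/-- The temporal Hankel tensor incoherence conditions with scale factor `k` and parameter `μ`. -/
def HankelIncoherent (k : ℕ) (μ : ℝ) (M : TimeSeries t n) : Prop :=
  0 < μ ∧ ∃ U S V, IsSkinnyTSVD (hankel k M) U S V ∧
    (∀ i : Fin t, frobTensor (tProd (tTranspose U) (colBasis i)) ≤
      √(μ * tSVDRank (hankel k M) / (t * (∏ j, n j : ℕ)))) ∧
    (∀ i : Fin k, frobTensor (tProd (tTranspose V) (colBasis i)) ≤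
      √(μ * tSVDRank (hankel k M) / (k * (∏ j, n j : ℕ))))

/-- `X` solves the noisy LRTC-TIDT model
`min ‖H_k(X)‖_⊛` subject to `‖P_Ω(X - Y)‖_F ≤ δ`. -/
def IsLRTCTIDTSolution (k : ℕ) (Ω : Finset (Fin t × Modes n)) (Y : TimeSeries t n) (δ : ℝ)
    (X : TimeSeries t n) : Prop :=
  frobSeries (sample Ω (X - Y)) ≤ δ ∧
    ∀ X' : TimeSeries t n, frobSeries (sample Ω (X' - Y)) ≤ δ →
      tnn (hankel k X) ≤ tnn (hankel k X')

end Model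

end TIDT

/-! In the Fourier domain the problem becomes one about block diagonal matrices: `bdiag` turns
t-products into matrix products and transposes into adjoints, and scales the squared Frobenius norm
by $n$. Write $\hat M-M$ as its unobserved part plus its observed part, and let $A,E,D$ be the
`bdiag` images of the Hankel tensors of $M$ and of these two parts. The observed part has norm at
most $2\delta$ because $M$ and $\hat M$ are both feasible, and minimality gives
$\|A+E+D\|_*\le\|A\|_*$.

No dual certificate has to be constructed in advance; the error supplies one
(`nuclearNorm_perturbation`). Let $Q$ be the polar factor of $A$ and $G$ the part of $E$ orthogonal
to the column and row spaces of $A$. Then $W=Q+G/\|G\|_F$ is a contraction, and pairing it with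
$A+E+D$ gives $\|A\|_*+\mathrm{Re}\langle Q,E\rangle+\|G\|_F+\mathrm{Re}\langle
W,D\rangle\le\|A\|_*$. Since $\|Q\|_F^2=\operatorname{rank}A$ and
$\|W\|_F^2=\operatorname{rank}A+1$, this bounds $\|G\|_F$ by $\|Q^*E\|_F$ and $\|D\|_F$.

The Hankel tensor behind $E$ has few nonzero entries per column and row, by the sampling rate. With
incoherence this leaves only a fraction $\beta=\alpha/(r_s+1)$ of $\|E\|_F^2$ in the two spaces
(`frobSq_hankel_unsampled_le`). Hence $\|G\|_F^2\ge(1-\beta)\|E\|_F^2$, and $\|E\|_F$ is controlled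
by $\|D\|_F$. -/

namespace TIDT

/-! ### Frobenius norms, projections and partial isometries. -/

section FrobeniusSq

variable {l m c d : Type} [Fintype l] [Fintype m] [Fintype c] [Fintype d]

open Matrix

/-- The squared Frobenius norm of a complex matrix. -/
noncomputable def frobSq (X : Matrix m l ℂ) : ℝ := ∑ i, ∑ j, ‖X i j‖ ^ 2

theorem frobSq_nonneg (X : Matrix m l ℂ) : 0 ≤ frobSq X := by
  unfold frobSq; positivity

theorem trace_conjTranspose_mul_self (X : Matrix m l ℂ) :
    (Xᴴ * X).trace = (frobSq X : ℂ) := by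
  unfold frobSq
  rw [Finset.sum_comm]
  simp [Matrix.trace, Matrix.mul_apply, Complex.conj_mul']

theorem frobSq_conjTranspose (X : Matrix m l ℂ) : frobSq Xᴴ = frobSq X := by
  unfold frobSq
  rw [Finset.sum_comm]
  simp

theorem frobSq_neg (X : Matrix m l ℂ) : frobSq (-X) = frobSq X := by
  simp [frobSq]

theorem frobSq_smul (a : ℝ) (X : Matrix m l ℂ) : frobSq ((a : ℂ) • X) = a ^ 2 * frobSq X := by
  simp [frobSq, Finset.mul_sum, mul_pow]

theorem frobSq_add_of_conjTranspose_mul_eq_zero (X Y : Matrix m l ℂ) (h : Xᴴ * Y = 0) :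
    frobSq (X + Y) = frobSq X + frobSq Y := by
  have h' : Yᴴ * X = 0 := by simpa using congrArg conjTranspose h
  have := trace_conjTranspose_mul_self (X + Y)
  rw [conjTranspose_add, Matrix.add_mul, Matrix.mul_add, Matrix.mul_add, h, h', add_zero, zero_add,
    trace_add, trace_conjTranspose_mul_self, trace_conjTranspose_mul_self] at this
  exact_mod_cast this.symm

/-- Cauchy-Schwarz for the Frobenius inner product. -/
theorem re_trace_conjTranspose_mul_le (X Y : Matrix m l ℂ) :
    (Xᴴ * Y).trace.re ≤ √(frobSq X) * √(frobSq Y) := by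
  have h1 : (Xᴴ * Y).trace.re ≤ ∑ q : m × l, ‖X q.1 q.2‖ * ‖Y q.1 q.2‖ := by
    rw [Fintype.sum_prod_type, Finset.sum_comm]
    simp only [Matrix.trace, Matrix.diag, Matrix.mul_apply, Complex.re_sum]
    refine Finset.sum_le_sum fun i _ => Finset.sum_le_sum fun j _ => ?_
    refine (Complex.re_le_norm _).trans ?_
    simp
  refine h1.trans ?_
  have := Real.sum_mul_le_sqrt_mul_sqrt Finset.univ (fun q : m × l => ‖X q.1 q.2‖)
    (fun q => ‖Y q.1 q.2‖)
  rw [Fintype.sum_prod_type (f := fun q : m × l => ‖X q.1 q.2‖ ^ 2),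
    Fintype.sum_prod_type (f := fun q : m × l => ‖Y q.1 q.2‖ ^ 2)] at this
  exact this

theorem neg_le_re_trace_conjTranspose_mul (X Y : Matrix m l ℂ) :
    -(√(frobSq X) * √(frobSq Y)) ≤ (Xᴴ * Y).trace.re := by
  have := re_trace_conjTranspose_mul_le X (-Y)
  rw [frobSq_neg, Matrix.mul_neg, trace_neg, Complex.neg_re] at this
  linarith

theorem frobSq_mul_of_isometry [DecidableEq m] (U : Matrix c m ℂ) (X : Matrix m l ℂ)
    (hU : Uᴴ * U = 1) : frobSq (U * X) = frobSq X := by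
  have := trace_conjTranspose_mul_self (U * X)
  rw [conjTranspose_mul, Matrix.mul_assoc, ← Matrix.mul_assoc Uᴴ, hU, Matrix.one_mul,
    trace_conjTranspose_mul_self] at this
  exact_mod_cast this.symm

theorem frobSq_eq_add_of_projection [DecidableEq m] (P : Matrix m m ℂ) (X : Matrix m l ℂ)
    (hP : Pᴴ = P) (hPP : P * P = P) :
    frobSq X = frobSq (P * X) + frobSq ((1 - P) * X) := by
  rw [← frobSq_add_of_conjTranspose_mul_eq_zero, ← Matrix.add_mul, add_sub_cancel, Matrix.one_mul]
  rw [conjTranspose_mul, hP, Matrix.mul_assoc, ← Matrix.mul_assoc P, Matrix.mul_sub, hPP,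
    Matrix.mul_one, sub_self, Matrix.zero_mul, Matrix.mul_zero]

theorem frobSq_projection_mul_le [DecidableEq m] (P : Matrix m m ℂ) (X : Matrix m l ℂ)
    (hP : Pᴴ = P) (hPP : P * P = P) : frobSq (P * X) ≤ frobSq X := by
  rw [frobSq_eq_add_of_projection P X hP hPP]
  linarith [frobSq_nonneg ((1 - P) * X)]

/-- A partial isometry preserves norms on the range of its adjoint, so the two products have the
same Gram matrix. -/
theorem frobSq_conjTranspose_mul_of_partialIsometry [DecidableEq m]
    (Q : Matrix m c ℂ) (X : Matrix m l ℂ) (hQ : Q * Qᴴ * Q = Q) :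
    frobSq (Q * Qᴴ * X) = frobSq (Qᴴ * X) := by
  have hQ' : Qᴴ * (Q * Qᴴ) = Qᴴ := by simpa using congrArg conjTranspose hQ
  have h := trace_conjTranspose_mul_self (Q * Qᴴ * X)
  have h2 := trace_conjTranspose_mul_self (Qᴴ * X)
  have : (Q * Qᴴ * X)ᴴ * (Q * Qᴴ * X) = (Qᴴ * X)ᴴ * (Qᴴ * X) := by
    simp only [conjTranspose_mul, conjTranspose_conjTranspose]
    rw [Matrix.mul_assoc Xᴴ, Matrix.mul_assoc Xᴴ, Matrix.mul_assoc Q, ← Matrix.mul_assoc Qᴴ, hQ']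
  rw [this, h2] at h
  exact_mod_cast h.symm

/-- The range of the partial isometry `Q` is contained in the range of the isometry `U`. -/
theorem frobSq_conjTranspose_mul_le_of_range_le [DecidableEq m] [DecidableEq d]
    (Q : Matrix m c ℂ) (U : Matrix m d ℂ) (X : Matrix m l ℂ) (hQ : Q * Qᴴ * Q = Q)
    (hU : Uᴴ * U = 1) (hUQ : U * Uᴴ * Q = Q) :
    frobSq (Qᴴ * X) ≤ frobSq (Uᴴ * X) := by
  have hUQ' : Qᴴ * (U * Uᴴ) = Qᴴ := by simpa using congrArg conjTranspose hUQ
  rw [← frobSq_mul_of_isometry U (Uᴴ * X) hU, ← frobSq_conjTranspose_mul_of_partialIsometry Q X hQ]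
  have : Q * Qᴴ * X = Q * Qᴴ * (U * (Uᴴ * X)) := by
    rw [← Matrix.mul_assoc U, ← Matrix.mul_assoc (Q * Qᴴ), Matrix.mul_assoc Q Qᴴ (U * Uᴴ), hUQ']
  rw [this]
  apply frobSq_projection_mul_le
  · simp
  · rw [← Matrix.mul_assoc, hQ]

theorem frobSq_mul_le (X : Matrix m l ℂ) (Y : Matrix l c ℂ) :
    frobSq (X * Y) ≤ frobSq X * frobSq Y := by
  unfold frobSq
  rw [Finset.sum_comm (s := (Finset.univ : Finset l)), Finset.sum_mul]
  refine Finset.sum_le_sum fun i _ => ?_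
  rw [Finset.mul_sum]
  refine Finset.sum_le_sum fun j _ => ?_
  rw [Matrix.mul_apply]
  calc ‖∑ k, X i k * Y k j‖ ^ 2 ≤ (∑ k, ‖X i k‖ * ‖Y k j‖) ^ 2 := by
        gcongr
        exact (norm_sum_le _ _).trans (by simp)
    _ ≤ _ := Finset.sum_mul_sq_le_sq_mul_sq _ _ _

end FrobeniusSq

/-! ### Nuclear norm, duality with contractions, polar decomposition. -/

section Nuclear

variable {l m c d : Type} [Fintype l] [Fintype m] [Fintype c] [Fintype d]
  [DecidableEq l] [DecidableEq m] [DecidableEq c] [DecidableEq d]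

open Matrix
open scoped ComplexOrder

theorem eigenvalues_congr {E : Type*} [NormedAddCommGroup E] [InnerProductSpace ℂ E]
    [FiniteDimensional ℂ E] {T S : E →ₗ[ℂ] E} (h : T = S) (hT : T.IsSymmetric)
    (hS : S.IsSymmetric) {N : ℕ} (hN : Module.finrank ℂ E = N) (i : Fin N) :
    hT.eigenvalues hN i = hS.eigenvalues hN i := by
  subst h; rfl

/-- Both sides run over the eigenvalues of $X^*X$; only the index types differ, and the bijection
chosen is the one inside `Matrix.IsHermitian.eigenvalues`. -/
theorem nuclearNorm_eq_sum_sqrt_eigenvalues (X : Matrix m l ℂ) :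
    nuclearNorm X = ∑ j, √((isHermitian_conjTranspose_mul_self X).eigenvalues j) := by
  unfold nuclearNorm
  rw [Finset.sum_range]
  refine Fintype.sum_equiv (Fintype.equivOfCardEq (Fintype.card_fin _)) _ _ fun i => ?_
  rw [LinearMap.singularValues_fin (Matrix.toEuclideanLin X) finrank_euclideanSpace i]
  unfold Matrix.IsHermitian.eigenvalues Matrix.IsHermitian.eigenvalues₀
  rw [Equiv.symm_apply_apply]
  congr 1
  apply eigenvalues_congr
  rw [← Matrix.toEuclideanLin_conjTranspose_eq_adjoint]
  ext v
  simp [Matrix.toEuclideanLin]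

/-- Right singular vectors and singular values. -/
theorem exists_right_singular (X : Matrix m l ℂ) :
    ∃ (V : Matrix l l ℂ) (s : l → ℝ), Vᴴ * V = 1 ∧ V * Vᴴ = 1 ∧ (∀ i, 0 ≤ s i) ∧
      Xᴴ * X = V * diagonal (fun i => (s i : ℂ) ^ 2) * Vᴴ ∧ nuclearNorm X = ∑ i, s i ∧
      X.rank = (Finset.univ.filter fun i => s i ≠ 0).card := by
  set hH := isHermitian_conjTranspose_mul_self X
  have hpos : ∀ i, 0 ≤ hH.eigenvalues i := (posSemidef_conjTranspose_mul_self X).eigenvalues_nonneg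
  refine ⟨hH.eigenvectorUnitary, fun i => √(hH.eigenvalues i),
    Unitary.coe_star_mul_self hH.eigenvectorUnitary,
    Unitary.coe_mul_star_self hH.eigenvectorUnitary, fun i => Real.sqrt_nonneg _, ?_,
    nuclearNorm_eq_sum_sqrt_eigenvalues X, ?_⟩
  · have h := hH.spectral_theorem
    rw [Unitary.conjStarAlgAut_apply] at h
    have h2 : (fun i => ((√(hH.eigenvalues i) : ℝ) : ℂ) ^ 2) = RCLike.ofReal ∘ hH.eigenvalues := by
      funext i
      rw [← Complex.ofReal_pow, Real.sq_sqrt (hpos i)]; rfl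
    rw [h2]; exact h
  · rw [← rank_conjTranspose_mul_self, hH.rank_eq_card_non_zero_eigs, Fintype.card_subtype]
    congr 1
    ext i
    simp [Real.sqrt_ne_zero (hpos i)]

/-- The easy half of the duality between the nuclear and the operator norm. -/
theorem re_trace_le_nuclearNorm (W X : Matrix m l ℂ)
    (hW : ∀ v : Matrix l Unit ℂ, frobSq (W * v) ≤ frobSq v) :
    (Wᴴ * X).trace.re ≤ nuclearNorm X := by
  obtain ⟨V, s, hV, hV', hs, hX, hn, -⟩ := exists_right_singular X
  -- In the basis of right singular vectors $v_i$ the trace is $\sum_i\langle Wv_i,Xv_i\rangle$,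
  -- where $\|Xv_i\|=s_i$ and $\|Wv_i\|\le1$.
  have h1 : (Wᴴ * X).trace = ((W * V)ᴴ * (X * V)).trace := by
    rw [conjTranspose_mul, Matrix.mul_assoc, trace_mul_comm Vᴴ, Matrix.mul_assoc,
      Matrix.mul_assoc, hV', Matrix.mul_one]
  have h2 : ((W * V)ᴴ * (X * V)).trace =
      ∑ i, ((W * V.submatrix id fun _ : Unit => i)ᴴ *
        (X * V.submatrix id fun _ : Unit => i)).trace := by
    simp [Matrix.trace, Matrix.mul_apply]
  rw [h1, h2, Complex.re_sum, hn]
  refine Finset.sum_le_sum fun i _ => (re_trace_conjTranspose_mul_le _ _).trans ?_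
  have h3 : frobSq (X * V.submatrix id fun _ : Unit => i) = s i ^ 2 := by
    have h4 : (X * V)ᴴ * (X * V) = diagonal (fun i => (s i : ℂ) ^ 2) := by
      rw [conjTranspose_mul, Matrix.mul_assoc, ← Matrix.mul_assoc Xᴴ, hX,
        Matrix.mul_assoc, hV, Matrix.mul_one, ← Matrix.mul_assoc, hV, Matrix.one_mul]
    have h5 := congrFun (congrFun h4 i) i
    have h6 := trace_conjTranspose_mul_self (X * V.submatrix id fun _ : Unit => i)
    rw [diagonal_apply_eq] at h5
    have h7 : ((X * V.submatrix id fun _ : Unit => i)ᴴ *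
      (X * V.submatrix id fun _ : Unit => i)).trace = ((X * V)ᴴ * (X * V)) i i := by
      simp [Matrix.trace, Matrix.mul_apply]
    rw [h7, h5] at h6
    exact_mod_cast h6.symm
  have h4 : frobSq (W * V.submatrix id fun _ : Unit => i) ≤ 1 := by
    refine (hW _).trans (le_of_eq ?_)
    have h6 := trace_conjTranspose_mul_self (V.submatrix id fun _ : Unit => i)
    have h7 : ((V.submatrix id fun _ : Unit => i)ᴴ *
      (V.submatrix id fun _ : Unit => i)).trace = (Vᴴ * V) i i := by
      simp [Matrix.trace, Matrix.mul_apply]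
    rw [h7, hV, one_apply_eq] at h6
    exact_mod_cast h6.symm
  rw [h3, Real.sqrt_sq (hs i)]
  exact mul_le_of_le_one_left (hs i) (Real.sqrt_le_one.mpr h4)

/-- The partial isometry `Q` of the polar decomposition of `A` (`U * Vᴴ` for a thin singular value
decomposition `A = U * S * Vᴴ`). -/
theorem exists_polar (A : Matrix m l ℂ) :
    ∃ (Q : Matrix m l ℂ) (Y : Matrix l l ℂ) (Y' : Matrix m m ℂ), Q = A * Y ∧ Q = Y' * A ∧
      Q * Qᴴ * A = A ∧ Q * Qᴴ * Q = Q ∧ (Qᴴ * A).trace = (nuclearNorm A : ℂ) ∧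
      frobSq Q = A.rank := by
  obtain ⟨V, s, hV, hV', hs, hA, hn, hr⟩ := exists_right_singular A
  set F : (l → ℂ) → Matrix l l ℂ := fun f => V * diagonal f * Vᴴ with hF
  have hmul : ∀ f g, F f * F g = F (f * g) := fun f g => by
    simp only [hF]
    rw [Matrix.mul_assoc, ← Matrix.mul_assoc Vᴴ, ← Matrix.mul_assoc Vᴴ, hV, Matrix.one_mul,
      ← Matrix.mul_assoc, Matrix.mul_assoc V, diagonal_mul_diagonal]
    rfl
  have htr : ∀ f, (F f).trace = ∑ i, f i := fun f => by
    simp only [hF]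
    rw [trace_mul_comm, ← Matrix.mul_assoc, hV, Matrix.one_mul, trace_diagonal]
  have hone : F 1 = 1 := by
    simp only [hF]
    rw [show diagonal (1 : l → ℂ) = 1 from diagonal_one, Matrix.mul_one, hV']
  have hsub : ∀ f g, F f - F g = F (f - g) := fun f g => by
    simp only [hF]
    rw [← Matrix.sub_mul, ← Matrix.mul_sub, diagonal_sub]; rfl
  set σ : l → ℂ := fun i => (s i : ℂ) with hσ
  -- Since `0⁻¹ = 0`, `σ⁻¹` is the pseudo-inverse and `σ⁻¹ * σ` the indicator of the nonzero
  -- singular values.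
  have hσσ : σ * (σ⁻¹ * σ) = σ := by
    funext i
    by_cases h : σ i = 0 <;> simp [h]
  have hi : σ⁻¹ * (σ⁻¹ * σ) = σ⁻¹ := by
    funext i
    by_cases h : σ i = 0 <;> simp [h]
  have hAA : Aᴴ * A = F (σ * σ) := by
    rw [hA]; simp only [hF]; congr 3; funext i; simp [hσ, sq]
  have hstar : (F σ⁻¹)ᴴ = F σ⁻¹ := by
    simp only [hF, conjTranspose_mul, conjTranspose_conjTranspose, diagonal_conjTranspose,
      Matrix.mul_assoc]
    congr 3
    funext i; simp [hσ]
  have hAP : A * F (σ⁻¹ * σ) = A := by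
    have h0 : A * (1 - F (σ⁻¹ * σ)) = 0 := by
      rw [← conjTranspose_mul_self_mul_eq_zero, hAA, ← hone, hsub, hmul]
      have : σ * σ * (1 - σ⁻¹ * σ) = 0 := by
        rw [mul_sub, mul_one, mul_assoc, hσσ, sub_self]
      rw [this]; simp [hF]
    rw [Matrix.mul_sub, Matrix.mul_one, sub_eq_zero] at h0
    exact h0.symm
  have hQQ : (A * F σ⁻¹)ᴴ * (A * F σ⁻¹) = F (σ⁻¹ * σ) := by
    rw [conjTranspose_mul, hstar, Matrix.mul_assoc, ← Matrix.mul_assoc Aᴴ, hAA, hmul, hmul]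
    congr 1
    calc σ⁻¹ * (σ * σ * σ⁻¹) = (σ⁻¹ * (σ⁻¹ * σ)) * σ := by ring
      _ = _ := by rw [hi]
  -- $Q=A|A|^{+}$. The left factor $Y'$ works because $A^*A=F(\sigma^2)$ reduces $\sigma^{-3}$ to
  -- $\sigma^{-1}$.
  refine ⟨A * F σ⁻¹, F σ⁻¹, A * F (σ⁻¹ * σ⁻¹ * σ⁻¹) * Aᴴ, rfl, ?_, ?_, ?_, ?_, ?_⟩
  · rw [Matrix.mul_assoc, hAA, Matrix.mul_assoc, hmul]
    congr 2
    calc σ⁻¹ = (σ⁻¹ * (σ⁻¹ * σ)) * (σ⁻¹ * σ) := by rw [hi, hi]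
      _ = _ := by ring
  · rw [conjTranspose_mul, hstar, Matrix.mul_assoc, Matrix.mul_assoc (F σ⁻¹), hAA, hmul,
      Matrix.mul_assoc, hmul]
    conv_rhs => rw [← hAP]
    congr 2
    calc σ⁻¹ * (σ⁻¹ * (σ * σ)) = (σ⁻¹ * (σ⁻¹ * σ)) * σ := by ring
      _ = _ := by rw [hi]
  · rw [Matrix.mul_assoc, hQQ, Matrix.mul_assoc, hmul, hi]
  · rw [conjTranspose_mul, hstar, Matrix.mul_assoc, hAA, hmul, htr, hn, Complex.ofReal_sum]
    refine Finset.sum_congr rfl fun i _ => ?_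
    have := congrFun hσσ i
    simp only [Pi.mul_apply, Pi.inv_apply] at this ⊢
    calc (σ i)⁻¹ * (σ i * σ i) = σ i * ((σ i)⁻¹ * σ i) := by ring
      _ = σ i := this
  · have h := trace_conjTranspose_mul_self (A * F σ⁻¹)
    rw [hQQ, htr] at h
    have h2 : ∑ i, (σ⁻¹ * σ) i = ((A.rank : ℝ) : ℂ) := by
      rw [hr, Finset.card_filter]
      push_cast
      refine Finset.sum_congr rfl fun i _ => ?_
      by_cases h : s i = 0 <;> simp [hσ, h]
    rw [h2] at h
    exact_mod_cast h.symm

end Nuclear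

/-! ### Stability of nuclear norm minimisation under perturbation. -/

section Stability

variable {l m c d : Type} [Fintype l] [Fintype m] [Fintype c] [Fintype d] [DecidableEq l]

open Matrix

/-- If `Q` is a partial isometry and `G` has orthogonal row and column spaces and Frobenius norm at
most one, then `Q + G` is a contraction. -/
theorem contraction_add_of_orthogonal (Q G : Matrix m l ℂ) (hQ : Q * Qᴴ * Q = Q)
    (hQG : Qᴴ * G = 0) (hGQ : G * Qᴴ = 0) (hG : frobSq G ≤ 1) (v : Matrix l Unit ℂ) :
    frobSq ((Q + G) * v) ≤ frobSq v := by
  have hQ' : Qᴴ * Q * Qᴴ = Qᴴ := by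
    simpa [Matrix.mul_assoc] using congrArg conjTranspose hQ
  rw [Matrix.add_mul, frobSq_add_of_conjTranspose_mul_eq_zero]
  · have h1 := frobSq_eq_add_of_projection (Qᴴ * Q) v (by simp) (by
      rw [← Matrix.mul_assoc, hQ'])
    have h2 := frobSq_conjTranspose_mul_of_partialIsometry Qᴴ v (by simpa using hQ')
    rw [conjTranspose_conjTranspose] at h2
    -- `Q` sees only the component of `v` in its row space and `G` only the complementary one, so
    -- the two bounds add up to the norm of `v`.
    have h3 : G * v = G * ((1 - Qᴴ * Q) * v) := by
      rw [Matrix.sub_mul, Matrix.one_mul, Matrix.mul_sub, Matrix.mul_assoc Qᴴ, ← Matrix.mul_assoc G,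
        hGQ, Matrix.zero_mul, sub_zero]
    have h4 := frobSq_mul_le G ((1 - Qᴴ * Q) * v)
    rw [h3]
    have := mul_le_of_le_one_left (frobSq_nonneg ((1 - Qᴴ * Q) * v)) hG
    linarith
  · rw [conjTranspose_mul, Matrix.mul_assoc, ← Matrix.mul_assoc Qᴴ, hQG, Matrix.zero_mul,
      Matrix.mul_zero]

/-- If perturbing `A` by `E + D` does not increase its nuclear norm, and `E` has only a small
component along the column and row spaces of `A`, then `E` is controlled by `D`. -/
theorem nuclearNorm_perturbation [DecidableEq m] [DecidableEq c] [DecidableEq d] (A E D : Matrix m l ℂ) (U : Matrix m c ℂ) (V : Matrix l d ℂ)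
    (hU : Uᴴ * U = 1) (hV : Vᴴ * V = 1) (hUA : U * Uᴴ * A = A) (hVA : V * Vᴴ * Aᴴ = Aᴴ) (β : ℝ)
    (hE : frobSq (Uᴴ * E) + frobSq (Vᴴ * Eᴴ) ≤ β * frobSq E)
    (hle : nuclearNorm (A + E + D) ≤ nuclearNorm A) :
    ∃ x : ℝ, 0 ≤ x ∧ (1 - β) * frobSq E ≤ x ^ 2 ∧
      x ≤ √A.rank * √(β * frobSq E) + √(A.rank + 1) * √(frobSq D) := by
  obtain ⟨Q, Y, Y', hQY, hQY', hQA, hQ, hQtr, hQrank⟩ := exists_polar A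
  have hQ' : Qᴴ * Q * Qᴴ = Qᴴ := by
    simpa [Matrix.mul_assoc] using congrArg conjTranspose hQ
  have hQE : frobSq (Qᴴ * E) ≤ frobSq (Uᴴ * E) :=
    frobSq_conjTranspose_mul_le_of_range_le Q U E hQ hU (by rw [hQY, ← Matrix.mul_assoc, hUA])
  have hEQ : frobSq (Q * Eᴴ) ≤ frobSq (Vᴴ * Eᴴ) := by
    have := frobSq_conjTranspose_mul_le_of_range_le Qᴴ V Eᴴ (by simpa using hQ') hV
      (by rw [hQY', conjTranspose_mul, ← Matrix.mul_assoc, hVA])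
    simpa using this
  -- `P` and `R` project orthogonally onto the column and row spaces of `A`.
  set P := Q * Qᴴ with hP
  set R := Qᴴ * Q with hR
  have hPP : P * P = P := by rw [hP, ← Matrix.mul_assoc, hQ]
  have hRR : R * R = R := by rw [hR, ← Matrix.mul_assoc, hQ']
  have hPH : Pᴴ = P := by simp [hP]
  have hRH : Rᴴ = R := by simp [hR]
  set G := (1 - P) * E * (1 - R) with hG
  have hQP : Qᴴ * (1 - P) = 0 := by
    rw [Matrix.mul_sub, Matrix.mul_one, hP, ← Matrix.mul_assoc, hQ', sub_self]
  have hRQ : (1 - R) * Qᴴ = 0 := by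
    rw [Matrix.sub_mul, Matrix.one_mul, hR, hQ', sub_self]
  have hQG : Qᴴ * G = 0 := by
    rw [hG, ← Matrix.mul_assoc, ← Matrix.mul_assoc, hQP, Matrix.zero_mul, Matrix.zero_mul]
  have hGQ : G * Qᴴ = 0 := by rw [hG, Matrix.mul_assoc, hRQ, Matrix.mul_zero]
  have hGH : Gᴴ = (1 - R) * (Eᴴ * (1 - P)) := by
    rw [hG, conjTranspose_mul, conjTranspose_mul, conjTranspose_sub, conjTranspose_sub, hPH, hRH,
      conjTranspose_one, conjTranspose_one]
  have hGA : Gᴴ * A = 0 := by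
    rw [hGH, Matrix.mul_assoc, Matrix.mul_assoc, Matrix.sub_mul 1 P, Matrix.one_mul, hQA, sub_self,
      Matrix.mul_zero, Matrix.mul_zero]
  have hGE : (Gᴴ * E).trace = (frobSq G : ℂ) := by
    rw [← trace_conjTranspose_mul_self]
    have h2 : Gᴴ * (1 - P) = Gᴴ := by
      rw [Matrix.mul_sub, Matrix.mul_one, hP, ← Matrix.mul_assoc,
        show Gᴴ * Q = 0 by simpa using congrArg conjTranspose hQG, Matrix.zero_mul, sub_zero]
    have h3 : (1 - R) * Gᴴ = Gᴴ := by
      rw [Matrix.sub_mul, Matrix.one_mul, hR, Matrix.mul_assoc,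
        show Q * Gᴴ = 0 by simpa using congrArg conjTranspose hGQ, Matrix.mul_zero, sub_zero]
    have h1 : Gᴴ * G = Gᴴ * E * (1 - R) := by
      conv_lhs => rw [hG]
      rw [← Matrix.mul_assoc, ← Matrix.mul_assoc, h2]
    rw [h1, trace_mul_comm (Gᴴ * E), ← Matrix.mul_assoc, h3]
  -- Orthogonal splitting $E=PE+(1-P)ER+G$; the middle term is no larger than $ER$, whose norm is
  -- that of $QE^*$.
  have hsplit : frobSq E ≤ frobSq (Qᴴ * E) + frobSq (Q * Eᴴ) + frobSq G := by
    have h1 := frobSq_eq_add_of_projection P E hPH hPP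
    have h2 := frobSq_eq_add_of_projection R ((1 - P) * E)ᴴ hRH hRR
    have h3 : (1 - R) * ((1 - P) * E)ᴴ = Gᴴ := by
      rw [hGH, conjTranspose_mul, conjTranspose_sub, hPH, conjTranspose_one]
    have h4 : R * ((1 - P) * E)ᴴ = ((1 - P) * (R * Eᴴ)ᴴ)ᴴ := by
      simp only [conjTranspose_mul, conjTranspose_conjTranspose, Matrix.mul_assoc]
    have h5 := frobSq_eq_add_of_projection P (R * Eᴴ)ᴴ hPH hPP
    have h6 := frobSq_conjTranspose_mul_of_partialIsometry Qᴴ Eᴴ (by simpa using hQ')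
    rw [conjTranspose_conjTranspose] at h6
    have h7 := frobSq_conjTranspose_mul_of_partialIsometry Q E hQ
    rw [h3, h4, frobSq_conjTranspose, frobSq_conjTranspose, frobSq_conjTranspose] at h2
    rw [frobSq_conjTranspose, h6] at h5
    rw [h7] at h1
    linarith [frobSq_nonneg (P * (R * Eᴴ)ᴴ)]
  have hQle : frobSq (Qᴴ * E) ≤ β * frobSq E := by linarith [frobSq_nonneg (Vᴴ * Eᴴ)]
  refine ⟨√(frobSq G), Real.sqrt_nonneg _, ?_, ?_⟩
  · rw [Real.sq_sqrt (frobSq_nonneg G)]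
    linarith
  rcases (frobSq_nonneg G).eq_or_lt with h0 | h0
  · rw [← h0, Real.sqrt_zero]; positivity
  set x := √(frobSq G) with hx
  have hx0 : 0 < x := Real.sqrt_pos.mpr h0
  have hxx : x ^ 2 = frobSq G := Real.sq_sqrt h0.le
  -- The test matrix: against `A` it yields the full nuclear norm, as $G^*A=0$, and its second
  -- summand against `E` yields exactly `x`.
  set W := Q + ((x⁻¹ : ℝ) : ℂ) • G with hW
  have hG1 : frobSq (((x⁻¹ : ℝ) : ℂ) • G) = 1 := by
    rw [frobSq_smul, ← hxx]
    field_simp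
  have hc := re_trace_le_nuclearNorm W (A + E + D) (contraction_add_of_orthogonal Q _ hQ
    (by rw [Matrix.mul_smul, hQG, smul_zero]) (by rw [Matrix.smul_mul, hGQ, smul_zero]) hG1.le)
  have hWH : Wᴴ = Qᴴ + ((x⁻¹ : ℝ) : ℂ) • Gᴴ := by
    simp [hW, conjTranspose_smul]
  have htr : (Wᴴ * (A + E + D)).trace.re =
      nuclearNorm A + (Qᴴ * E).trace.re + x + (Wᴴ * D).trace.re := by
    rw [Matrix.mul_add, Matrix.mul_add, trace_add, trace_add]
    conv_lhs => rw [hWH]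
    rw [Matrix.add_mul, Matrix.add_mul, Matrix.smul_mul, hGA, smul_zero, add_zero, hQtr,
      trace_add, Matrix.smul_mul, trace_smul, hGE, ← hWH, smul_eq_mul, ← Complex.ofReal_mul, ← hxx]
    simp only [Complex.add_re, Complex.ofReal_re]
    have : x⁻¹ * x ^ 2 = x := by field_simp
    rw [this]; ring
  have hWsq : frobSq W = A.rank + 1 := by
    rw [hW, frobSq_add_of_conjTranspose_mul_eq_zero _ _ (by rw [Matrix.mul_smul, hQG, smul_zero]),
      hG1, hQrank]
  have hD := neg_le_re_trace_conjTranspose_mul W D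
  -- Replacing `E` by `P * E` lets Cauchy–Schwarz see only the small component
  -- $\|PE\|_F=\|Q^*E\|_F$.
  have hQQE : (Qᴴ * E).trace = (Qᴴ * (P * E)).trace := by
    rw [hP, ← Matrix.mul_assoc Qᴴ, ← Matrix.mul_assoc Qᴴ Q, hQ']
  have hE' := neg_le_re_trace_conjTranspose_mul Q (P * E)
  rw [hWsq] at hD
  rw [← hQQE, hQrank, frobSq_conjTranspose_mul_of_partialIsometry Q E hQ] at hE'
  have hmono : √(A.rank : ℝ) * √(frobSq (Qᴴ * E)) ≤ √(A.rank : ℝ) * √(β * frobSq E) := by gcongr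
  linarith

end Stability

/-! ### Rank and Frobenius norm of block diagonal matrices. -/

section BlockDiagonal

variable {l m : Type} [Fintype l]

open Matrix

theorem rank_add_le (X Y : Matrix m l ℂ) : (X + Y).rank ≤ X.rank + Y.rank := by
  unfold Matrix.rank
  rw [Matrix.mulVecLin_add]
  exact (Submodule.finrank_mono (LinearMap.range_add_le _ _)).trans
    (Submodule.finrank_add_le_finrank_add_finrank _ _)

theorem rank_sum_le {ι : Type} (s : Finset ι) (f : ι → Matrix m l ℂ) :
    (∑ i ∈ s, f i).rank ≤ ∑ i ∈ s, (f i).rank := by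
  classical
  induction s using Finset.induction_on with
  | empty => simp
  | insert i s hi ih =>
    rw [Finset.sum_insert hi, Finset.sum_insert hi]
    exact (rank_add_le _ _).trans (by gcongr)

/-- Subadditivity of rank, after writing the matrix as a sum of single blocks moved into place by
0-1 matrices. The final bound on `x` is monotone in the rank, so an inequality suffices. -/
theorem rank_blockDiagonal_le [Fintype m] [DecidableEq l] [DecidableEq m] {o : Type} [Fintype o] [DecidableEq o] (B : o → Matrix m l ℂ) :
    (blockDiagonal B).rank ≤ ∑ ξ, (B ξ).rank := by
  have h : blockDiagonal B = ∑ ξ, (Matrix.of fun (q : m × o) i => if q.1 = i ∧ q.2 = ξ then (1 : ℂ) else 0)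
      * B ξ * (Matrix.of fun j (q : l × o) => if q.1 = j ∧ q.2 = ξ then (1 : ℂ) else 0) := by
    ext ⟨i, ξ⟩ ⟨j, η⟩
    rw [Matrix.sum_apply]
    simp only [Matrix.mul_apply, Matrix.of_apply, blockDiagonal_apply, ite_and, Finset.sum_ite_eq,
      mul_ite, ite_mul, mul_one, mul_zero, one_mul, zero_mul, Finset.mem_univ, if_true]
    split_ifs with h
    · rw [h]
    · rfl
  rw [h]
  refine (rank_sum_le _ _).trans (Finset.sum_le_sum fun ξ _ => ?_)
  exact (rank_mul_le_left _ _).trans (rank_mul_le_right _ _)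

theorem frobSq_blockDiagonal [Fintype m] {o : Type} [Fintype o] [DecidableEq o] (B : o → Matrix m l ℂ) :
    frobSq (blockDiagonal B) = ∑ ξ, frobSq (B ξ) := by
  unfold frobSq
  rw [Fintype.sum_prod_type, Finset.sum_comm]
  refine Finset.sum_congr rfl fun ξ _ => Finset.sum_congr rfl fun i _ => ?_
  rw [Fintype.sum_prod_type]
  refine Finset.sum_congr rfl fun j _ => ?_
  rw [Finset.sum_eq_single ξ]
  · simp
  · intro η _ h
    simp [blockDiagonal_apply, h.symm]
  · simp

end BlockDiagonal

/-! ### Convolution theorem and Parseval identity for the transform along the last modes. -/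

section Fourier

variable {p : ℕ} {n : Fin p → ℕ} [∀ j, NeZero (n j)]

/-- The kernel of the discrete Fourier transform along the last `p` modes. -/
noncomputable def dftKernel (ν ξ : Modes n) : ℂ := ∏ j, ZMod.stdAddChar (-(ν j * ξ j))

theorem dftKernel_add (ν κ ξ : Modes n) :
    dftKernel (ν + κ) ξ = dftKernel ν ξ * dftKernel κ ξ := by
  unfold dftKernel
  rw [← Finset.prod_mul_distrib]
  refine Finset.prod_congr rfl fun j _ => ?_
  rw [← AddChar.map_add_eq_mul]
  congr 1
  simp only [Pi.add_apply]
  ring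

theorem conj_dftKernel (ν ξ : Modes n) :
    (starRingEnd ℂ) (dftKernel ν ξ) = dftKernel (-ν) ξ := by
  unfold dftKernel
  rw [map_prod]
  refine Finset.prod_congr rfl fun j _ => ?_
  rw [← AddChar.map_neg_eq_conj]
  simp

theorem sum_dftKernel (ν : Modes n) :
    ∑ ξ, dftKernel ν ξ = if ν = 0 then ((∏ j, n j : ℕ) : ℂ) else 0 := by
  have h : ∀ j, ∑ x : ZMod (n j), ZMod.stdAddChar (-(ν j * x)) =
      if ν j = 0 then (n j : ℂ) else 0 := fun j => by
    have := AddChar.sum_mulShift (-(ν j)) (ZMod.isPrimitive_stdAddChar (n j))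
    simp only [ZMod.card, neg_eq_zero, Nat.cast_ite, Nat.cast_zero] at this
    rw [← this]
    refine Finset.sum_congr rfl fun x _ => ?_
    congr 1; ring
  unfold dftKernel
  rw [← Fintype.prod_sum (f := fun j (x : ZMod (n j)) => ZMod.stdAddChar (-(ν j * x)))]
  simp_rw [h]
  split_ifs with h0
  · subst h0; simp
  · obtain ⟨j, hj⟩ := Function.ne_iff.mp h0
    exact Finset.prod_eq_zero (Finset.mem_univ j) (if_neg hj)

theorem dft_apply {a b : ℕ} (Z : Tensor a b n ℝ) (ξ : Modes n) (i : Fin a) (j : Fin b) :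
    dft Z ξ i j = ∑ ν, dftKernel ν ξ * (Z ν i j : ℂ) := by
  simp [dft, Matrix.sum_apply, dftKernel]

theorem dft_add {a b : ℕ} (Z Z' : Tensor a b n ℝ) : dft (Z + Z') = dft Z + dft Z' := by
  ext ξ i j
  simp only [Pi.add_apply, Matrix.add_apply, dft_apply, Complex.ofReal_add, mul_add,
    Finset.sum_add_distrib]

theorem dft_tProd {a b c : ℕ} (A : Tensor a b n ℝ) (B : Tensor b c n ℝ) (ξ : Modes n) :
    dft (tProd A B) ξ = dft A ξ * dft B ξ := by
  ext i l
  simp only [dft_apply, Matrix.mul_apply, tProd, Matrix.of_apply, Complex.ofReal_sum,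
    Complex.ofReal_mul, Finset.mul_sum, Finset.sum_mul]
  rw [Finset.sum_comm]
  refine Finset.sum_congr rfl fun j _ => ?_
  rw [Finset.sum_comm]
  rw [Finset.sum_comm (s := (Finset.univ : Finset (Modes n))) (t := Finset.univ)]
  rw [Finset.sum_comm]
  conv_rhs => rw [Finset.sum_comm]
  refine Finset.sum_congr rfl fun κ _ => ?_
  rw [← Equiv.sum_comp (Equiv.addRight κ)]
  refine Finset.sum_congr rfl fun τ _ => ?_
  simp only [Equiv.coe_addRight, add_sub_cancel_right, dftKernel_add]
  ring

/-- Parseval for one tube: expand the square and use orthogonality of characters. The factor $n$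
reflects the unnormalised transform. -/
theorem sum_normSq_dft (z : Modes n → ℝ) :
    ∑ ξ, ‖∑ ν, dftKernel ν ξ * (z ν : ℂ)‖ ^ 2 = ((∏ j, n j : ℕ) : ℝ) * ∑ ν, z ν ^ 2 := by
  have h : ∀ ξ, ((‖∑ ν, dftKernel ν ξ * (z ν : ℂ)‖ ^ 2 : ℝ) : ℂ) =
      ∑ ν, ∑ κ, (z ν : ℂ) * z κ * dftKernel (-ν + κ) ξ := fun ξ => by
    push_cast
    rw [← Complex.conj_mul', map_sum, Finset.sum_mul_sum]
    refine Finset.sum_congr rfl fun ν _ => Finset.sum_congr rfl fun κ _ => ?_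
    rw [map_mul, conj_dftKernel, Complex.conj_ofReal, dftKernel_add]
    ring
  have h2 : ((∑ ξ, ‖∑ ν, dftKernel ν ξ * (z ν : ℂ)‖ ^ 2 : ℝ) : ℂ) =
      (((∏ j, n j : ℕ) : ℝ) * ∑ ν, z ν ^ 2 : ℝ) := by
    rw [Complex.ofReal_sum]
    simp_rw [h]
    rw [Finset.sum_comm, Complex.ofReal_mul, Complex.ofReal_sum, Finset.mul_sum]
    refine Finset.sum_congr rfl fun ν _ => ?_
    rw [Finset.sum_comm]
    simp_rw [← Finset.mul_sum, sum_dftKernel]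
    rw [Finset.sum_eq_single ν]
    · simp; ring
    · intro κ _ hκ
      rw [if_neg, mul_zero]
      rw [neg_add_eq_zero]; exact hκ.symm
    · simp
  exact_mod_cast h2

theorem frobTensor_sq {a b : ℕ} (Z : Tensor a b n ℝ) :
    frobTensor Z ^ 2 = ∑ ν, ∑ i, ∑ j, Z ν i j ^ 2 :=
  Real.sq_sqrt (by positivity)

theorem frobTensor_tTranspose {a b : ℕ} (Z : Tensor a b n ℝ) :
    frobTensor (tTranspose Z) = frobTensor Z := by
  unfold frobTensor
  congr 1
  rw [← Equiv.sum_comp (Equiv.neg (Modes n))]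
  refine Finset.sum_congr rfl fun ν _ => ?_
  rw [Finset.sum_comm]
  simp [tTranspose]

/-- The block diagonal matrix of the Fourier-domain face slices. -/
noncomputable def bdiag {a b : ℕ} (Z : Tensor a b n ℝ) :
    Matrix (Fin a × Modes n) (Fin b × Modes n) ℂ := Matrix.blockDiagonal (dft Z)

theorem frobSq_bdiag {a b : ℕ} (Z : Tensor a b n ℝ) :
    frobSq (bdiag Z) = ((∏ j, n j : ℕ) : ℝ) * frobTensor Z ^ 2 := by
  rw [bdiag, frobSq_blockDiagonal, frobTensor_sq]
  unfold frobSq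
  simp_rw [dft_apply]
  rw [Finset.sum_comm, Finset.sum_comm (s := (Finset.univ : Finset (Modes n))), Finset.mul_sum]
  refine Finset.sum_congr rfl fun i _ => ?_
  rw [Finset.sum_comm, Finset.sum_comm (s := (Finset.univ : Finset (Modes n))), Finset.mul_sum]
  exact Finset.sum_congr rfl fun j _ => sum_normSq_dft _

theorem bdiag_add {a b : ℕ} (Z Z' : Tensor a b n ℝ) : bdiag (Z + Z') = bdiag Z + bdiag Z' := by
  rw [bdiag, dft_add, Matrix.blockDiagonal_add]; rfl

theorem bdiag_tProd {a b c : ℕ} (A : Tensor a b n ℝ) (B : Tensor b c n ℝ) :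
    bdiag (tProd A B) = bdiag A * bdiag B := by
  rw [bdiag, bdiag, bdiag, ← Matrix.blockDiagonal_mul]
  congr 1
  funext ξ
  exact dft_tProd A B ξ

theorem bdiag_tTranspose {a b : ℕ} (Z : Tensor a b n ℝ) :
    bdiag (tTranspose Z) = (bdiag Z).conjTranspose := by
  rw [bdiag, bdiag, Matrix.blockDiagonal_conjTranspose]
  congr 1
  funext ξ
  exact dft_tTranspose Z ξ

theorem bdiag_tIdentity (a : ℕ) : bdiag (tIdentity a : Tensor a a n ℝ) = 1 := by
  rw [bdiag, ← Matrix.blockDiagonal_one]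
  congr 1
  funext ξ
  exact dft_tIdentity a ξ

end Fourier

/-! ### Incoherent tensors act weakly on sparse ones. -/

section Incoherence

variable {p : ℕ} {n : Fin p → ℕ} [∀ j, NeZero (n j)]

theorem frobTensor_tProd_colBasis_sq {a c : ℕ} (G : Tensor c a n ℝ) (i : Fin a) :
    frobTensor (tProd G (colBasis i)) ^ 2 = ∑ ν, ∑ b, G ν b i ^ 2 := by
  rw [frobTensor_sq]
  refine Finset.sum_congr rfl fun ν _ => Finset.sum_congr rfl fun b _ => ?_
  rw [Fin.sum_univ_one]
  congr 1
  simp only [tProd, colBasis, Matrix.of_apply]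
  rw [Finset.sum_eq_single i, Finset.sum_eq_single ν]
  · simp
  · intro κ _ hκ
    simp [sub_eq_zero, hκ.symm]
  · simp
  · intro i' _ hi
    simp [hi]
  · simp

/-- A t-product with a temporally sparse tensor is small when the lateral slices of the left factor
are small. -/
theorem frobTensor_tProd_sq_le {a b c : ℕ} (G : Tensor c a n ℝ) (Z : Tensor a b n ℝ) {g s : ℝ}
    (hg0 : 0 ≤ g) (hg : ∀ i, frobTensor (tProd G (colBasis i)) ^ 2 ≤ g)
    (hs : ∀ ν j, ((Finset.univ.filter fun i => Z ν i j ≠ 0).card : ℝ) ≤ s) :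
    frobTensor (tProd G Z) ^ 2 ≤ g * s * ((∏ j, n j : ℕ) : ℝ) * frobTensor Z ^ 2 := by
  have hcol : ∀ j, ∑ ν, ∑ e, tProd G Z ν e j ^ 2 ≤
      g * s * ((∏ j, n j : ℕ) : ℝ) * ∑ ν, ∑ i, Z ν i j ^ 2 := fun j => by
    set S : Finset (Modes n × Fin a) := Finset.univ.filter fun q => Z q.1 q.2 j ≠ 0 with hS
    have hcard : (S.card : ℝ) ≤ s * ((∏ j, n j : ℕ) : ℝ) := by
      have h1 : S.card = ∑ ν, (Finset.univ.filter fun i => Z ν i j ≠ 0).card := by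
        simp only [hS, Finset.card_filter, Fintype.sum_prod_type]
      have h2 : (Fintype.card (Modes n) : ℝ) = ((∏ j, n j : ℕ) : ℝ) := by
        simp [Fintype.card_pi, ZMod.card]
      rw [h1, Nat.cast_sum, ← h2]
      refine (Finset.sum_le_sum fun ν _ => hs ν j).trans ?_
      simp [mul_comm]
    have hz : ∑ q ∈ S, Z q.1 q.2 j ^ 2 = ∑ ν, ∑ i, Z ν i j ^ 2 := by
      rw [← Fintype.sum_prod_type' (f := fun ν i => Z ν i j ^ 2)]
      refine Finset.sum_subset (Finset.subset_univ _) fun q _ hq => ?_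
      have : Z q.1 q.2 j = 0 := by simpa [hS] using hq
      simp [this]
    -- Cauchy–Schwarz restricted to the support `S` of column `j`: the convolution becomes a sum of
    -- at most $sn$ terms.
    have hentry : ∀ ν e, tProd G Z ν e j ^ 2 ≤
        (∑ q ∈ S, G (ν - q.1) e q.2 ^ 2) * ∑ ν, ∑ i, Z ν i j ^ 2 := fun ν e => by
      have h1 : tProd G Z ν e j = ∑ q ∈ S, G (ν - q.1) e q.2 * Z q.1 q.2 j := by
        have h2 : ∑ q ∈ S, G (ν - q.1) e q.2 * Z q.1 q.2 j =
            ∑ q : Modes n × Fin a, G (ν - q.1) e q.2 * Z q.1 q.2 j := by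
          refine Finset.sum_subset (Finset.subset_univ _) fun q _ hq => ?_
          have : Z q.1 q.2 j = 0 := by simpa [hS] using hq
          simp [this]
        rw [h2, Fintype.sum_prod_type, Finset.sum_comm]
        simp only [tProd, Matrix.of_apply]
        refine Finset.sum_congr rfl fun i _ => ?_
        rw [← Equiv.sum_comp (Equiv.subLeft ν)]
        simp
      rw [h1, ← hz]
      exact Finset.sum_mul_sq_le_sq_mul_sq _ _ _
    -- Summing over `ν` first removes the shift by `q.1`, so each point of `S` contributes the norm
    -- of one lateral slice, at most `g`.
    have hG : ∑ ν, ∑ e, ∑ q ∈ S, G (ν - q.1) e q.2 ^ 2 ≤ g * s * ((∏ j, n j : ℕ) : ℝ) := by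
      have h1 : ∑ ν, ∑ e, ∑ q ∈ S, G (ν - q.1) e q.2 ^ 2 =
          ∑ q ∈ S, frobTensor (tProd G (colBasis q.2)) ^ 2 := by
        simp_rw [Finset.sum_comm (t := S)]
        refine Finset.sum_congr rfl fun q _ => ?_
        rw [frobTensor_tProd_colBasis_sq]
        exact Equiv.sum_comp (Equiv.subRight q.1) fun ν => ∑ e, G ν e q.2 ^ 2
      rw [h1]
      refine (Finset.sum_le_sum fun q _ => hg q.2).trans ?_
      rw [Finset.sum_const, nsmul_eq_mul, mul_assoc, mul_comm]
      exact mul_le_mul_of_nonneg_left hcard hg0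
    calc ∑ ν, ∑ e, tProd G Z ν e j ^ 2
        ≤ ∑ ν, ∑ e, (∑ q ∈ S, G (ν - q.1) e q.2 ^ 2) * ∑ ν, ∑ i, Z ν i j ^ 2 :=
          Finset.sum_le_sum fun ν _ => Finset.sum_le_sum fun e _ => hentry ν e
      _ = (∑ ν, ∑ e, ∑ q ∈ S, G (ν - q.1) e q.2 ^ 2) * ∑ ν, ∑ i, Z ν i j ^ 2 := by
          simp_rw [← Finset.sum_mul]
      _ ≤ _ := mul_le_mul_of_nonneg_right hG (by positivity)
  have hcomm : ∀ {e : ℕ} (T : Tensor e b n ℝ),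
      frobTensor T ^ 2 = ∑ j, ∑ ν, ∑ i, T ν i j ^ 2 := fun T => by
    rw [frobTensor_sq, Finset.sum_comm (s := (Finset.univ : Finset (Fin b)))]
    exact Finset.sum_congr rfl fun ν _ => Finset.sum_comm
  rw [hcomm, hcomm, Finset.mul_sum]
  exact Finset.sum_le_sum fun j _ => hcol j

end Incoherence

/-! ### Sampling and norms of time series. -/

section Series

variable {p : ℕ} {n : Fin p → ℕ} {t : ℕ}

theorem sample_sub (Ω : Finset (Fin t × Modes n)) (X Y : TimeSeries t n) :
    sample Ω (X - Y) = sample Ω X - sample Ω Y := by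
  ext i ν
  by_cases h : (i, ν) ∈ Ω <;> simp [sample, h]

variable [∀ j, NeZero (n j)]

theorem frobSeries_nonneg (X : TimeSeries t n) : 0 ≤ frobSeries X := Real.sqrt_nonneg _

theorem frobSeries_eq_norm (X : TimeSeries t n) :
    frobSeries X = ‖WithLp.toLp 2 fun q : Fin t × Modes n => X q.1 q.2‖ := by
  rw [EuclideanSpace.norm_eq, Fintype.sum_prod_type]
  simp [frobSeries]

theorem frobSeries_sub_le (X Y : TimeSeries t n) :
    frobSeries (X - Y) ≤ frobSeries X + frobSeries Y := by
  simp only [frobSeries_eq_norm]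
  exact norm_sub_le (WithLp.toLp 2 fun q : Fin t × Modes n => X q.1 q.2)
    (WithLp.toLp 2 fun q : Fin t × Modes n => Y q.1 q.2)

theorem frobSeries_add_le (X Y : TimeSeries t n) :
    frobSeries (X + Y) ≤ frobSeries X + frobSeries Y := by
  simp only [frobSeries_eq_norm]
  exact norm_add_le (WithLp.toLp 2 fun q : Fin t × Modes n => X q.1 q.2)
    (WithLp.toLp 2 fun q : Fin t × Modes n => Y q.1 q.2)

theorem sample_compl_add_sample (Ω : Finset (Fin t × Modes n)) (X : TimeSeries t n) :
    sample Ωᶜ X + sample Ω X = X := by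
  ext i ν
  by_cases h : (i, ν) ∈ Ω <;> simp [sample, h]

theorem samplingNumber_compl_le (Ω : Finset (Fin t × Modes n)) (ν : Modes n) :
    (samplingNumber Ωᶜ ν : ℝ) ≤ t * (1 - minSamplingRate Ω) := by
  have h1 : samplingNumber Ω ν + samplingNumber Ωᶜ ν = t := by
    simp only [samplingNumber, Finset.mem_compl]
    rw [Finset.card_filter_add_card_filter_not, Finset.card_univ, Fintype.card_fin]
  have h2 : minSamplingRate Ω ≤ (samplingNumber Ω ν : ℝ) / t :=
    Finset.inf'_le (fun ν : Modes n => (samplingNumber Ω ν : ℝ) / (t : ℝ)) (Finset.mem_univ ν)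
  have h3 : (samplingNumber Ω ν : ℝ) + samplingNumber Ωᶜ ν = t := by exact_mod_cast h1
  rcases Nat.eq_zero_or_pos t with h0 | h0
  · subst h0
    have : samplingNumber Ωᶜ ν = 0 := by omega
    simp [this]
  · have h0' : (0 : ℝ) < t := by exact_mod_cast h0
    rw [le_div_iff₀ h0'] at h2
    linarith

theorem minSamplingRate_le_one (Ω : Finset (Fin t × Modes n)) (ht : 0 < t) :
    minSamplingRate Ω ≤ 1 := by
  have h := (Nat.cast_nonneg (samplingNumber Ωᶜ (0 : Modes n))).trans (samplingNumber_compl_le Ω 0)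
  have h0 : (0 : ℝ) < t := by exact_mod_cast ht
  linarith [(mul_nonneg_iff_of_pos_left h0).mp h]

end Series

/-! ### The Hankel transform: isometry, sparsity and incoherence. -/

section Hankel

variable {p : ℕ} {n : Fin p → ℕ} {t : ℕ}

theorem injective_add_mod (j : ℕ) :
    Function.Injective fun i : Fin t => (⟨((i : ℕ) + j) % t, Nat.mod_lt _ i.pos⟩ : Fin t) := by
  intro a b h
  have h1 : (a + j : ℕ) ≡ b + j [MOD t] := congrArg Fin.val h
  have h2 := Nat.ModEq.add_right_cancel' j h1
  exact Fin.ext (Nat.ModEq.eq_of_lt_of_lt h2 a.2 b.2)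

/-- A row of the Hankel tensor covers `k` consecutive times; `k ≤ t` prevents wrapping onto a
repeated one. -/
theorem injective_mod_add {k : ℕ} (hkt : k ≤ t) (i : Fin t) :
    Function.Injective fun j : Fin k => (⟨((i : ℕ) + j) % t, Nat.mod_lt _ i.pos⟩ : Fin t) := by
  intro a b h
  have h1 : (i + a : ℕ) ≡ i + b [MOD t] := congrArg Fin.val h
  have h2 := Nat.ModEq.add_left_cancel' (i : ℕ) h1
  exact Fin.ext (Nat.ModEq.eq_of_lt_of_lt h2 (a.2.trans_le hkt) (b.2.trans_le hkt))

theorem hankel_add (k : ℕ) (X Y : TimeSeries t n) :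
    hankel k (X + Y) = hankel k X + hankel k Y := by
  ext ν i j
  simp [hankel, mul_add]

theorem hankel_sample_ne_zero {k : ℕ} {Ω : Finset (Fin t × Modes n)} {X : TimeSeries t n}
    {ν : Modes n} {i : Fin t} {j : Fin k} (h : hankel k (sample Ω X) ν i j ≠ 0) :
    ((⟨((i : ℕ) + (j : ℕ)) % t, Nat.mod_lt _ i.pos⟩ : Fin t), ν) ∈ Ω := by
  by_contra hΩ
  exact h (by simp [hankel, sample, hΩ])

theorem card_hankel_column_le (k : ℕ) (Ω : Finset (Fin t × Modes n)) (X : TimeSeries t n)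
    (ν : Modes n) (j : Fin k) :
    (Finset.univ.filter fun i => hankel k (sample Ω X) ν i j ≠ 0).card ≤ samplingNumber Ω ν :=
  Finset.card_le_card_of_injOn
    (fun i : Fin t => (⟨((i : ℕ) + (j : ℕ)) % t, Nat.mod_lt _ i.pos⟩ : Fin t))
    (fun i hi => by
      simp only [Finset.coe_filter, Finset.mem_univ, true_and, Set.mem_ofPred_eq] at hi ⊢
      exact hankel_sample_ne_zero hi)
    (injective_add_mod (j : ℕ)).injOn

theorem card_hankel_row_le {k : ℕ} (hkt : k ≤ t) (Ω : Finset (Fin t × Modes n))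
    (X : TimeSeries t n) (ν : Modes n) (i : Fin t) :
    (Finset.univ.filter fun j => hankel k (sample Ω X) ν i j ≠ 0).card ≤ samplingNumber Ω ν :=
  Finset.card_le_card_of_injOn
    (fun j : Fin k => (⟨((i : ℕ) + (j : ℕ)) % t, Nat.mod_lt _ i.pos⟩ : Fin t))
    (fun j hj => by
      simp only [Finset.coe_filter, Finset.mem_univ, true_and, Set.mem_ofPred_eq] at hj ⊢
      exact hankel_sample_ne_zero hj)
    (injective_mod_add hkt i).injOn

variable [∀ j, NeZero (n j)]

/-- The temporal Hankel transform is an isometry. -/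
theorem frobTensor_hankel {k : ℕ} (hk : 0 < k) (X : TimeSeries t n) :
    frobTensor (hankel k X) = frobSeries X := by
  have hk' : (k : ℝ) ≠ 0 := by positivity
  have hcol : ∀ ν (j : Fin k), ∑ i, hankel k X ν i j ^ 2 = (k : ℝ)⁻¹ * ∑ i, X i ν ^ 2 := by
    intro ν j
    have hb := Finite.injective_iff_bijective.mp (injective_add_mod (t := t) (j : ℕ))
    rw [← hb.sum_comp fun i => X i ν ^ 2, Finset.mul_sum]
    refine Finset.sum_congr rfl fun i _ => ?_
    simp only [hankel, Matrix.of_apply, mul_pow, one_div, inv_pow]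
    rw [Real.sq_sqrt (Nat.cast_nonneg k)]
  unfold frobTensor frobSeries
  congr 1
  rw [Finset.sum_comm (s := (Finset.univ : Finset (Fin t)))]
  refine Finset.sum_congr rfl fun ν _ => ?_
  rw [Finset.sum_comm]
  simp_rw [hcol]
  rw [Finset.sum_const, Finset.card_univ, Fintype.card_fin, nsmul_eq_mul,
    mul_inv_cancel_left₀ hk']

/-- The unobserved part of a temporal Hankel tensor has small components along spaces spanned by
incoherent orthonormal tensors. -/
theorem frobSq_hankel_unsampled_le {k r : ℕ} (hk : 0 < k) (hkt : k ≤ t) {μ : ℝ} (hμ : 0 ≤ μ)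
    (U : Tensor t r n ℝ) (V : Tensor k r n ℝ)
    (hU : ∀ i, frobTensor (tProd (tTranspose U) (colBasis i)) ≤
      √(μ * r / (t * (∏ j, n j : ℕ))))
    (hV : ∀ i, frobTensor (tProd (tTranspose V) (colBasis i)) ≤
      √(μ * r / (k * (∏ j, n j : ℕ))))
    (Ω : Finset (Fin t × Modes n)) (X : TimeSeries t n) {β : ℝ}
    (hβ : 2 * (μ * r * t * (1 - minSamplingRate Ω)) ≤ β * k) :
    frobSq ((bdiag U).conjTranspose * bdiag (hankel k (sample Ωᶜ X))) +
      frobSq ((bdiag V).conjTranspose * (bdiag (hankel k (sample Ωᶜ X))).conjTranspose) ≤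
      β * frobSq (bdiag (hankel k (sample Ωᶜ X))) := by
  have ht : 0 < t := hk.trans_le hkt
  have hN : (0 : ℝ) < ((∏ j, n j : ℕ) : ℝ) := by
    exact_mod_cast Finset.prod_pos fun j _ => Nat.pos_of_neZero (n j)
  have hk' : (0 : ℝ) < k := by exact_mod_cast hk
  have ht' : (0 : ℝ) < t := by exact_mod_cast ht
  have hkt' : (k : ℝ) ≤ t := by exact_mod_cast hkt
  set Z := hankel k (sample Ωᶜ X) with hZ
  have h1 := frobTensor_tProd_sq_le (tTranspose U) Z (g := μ * r / (t * (∏ j, n j : ℕ)))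
    (s := t * (1 - minSamplingRate Ω)) (by positivity)
    (fun i => (Real.le_sqrt (Real.sqrt_nonneg _) (by positivity)).mp (hU i))
    (fun ν j => (Nat.cast_le.mpr (card_hankel_column_le k Ωᶜ X ν j)).trans
      (samplingNumber_compl_le Ω ν))
  have h2 := frobTensor_tProd_sq_le (tTranspose V) (tTranspose Z)
    (g := μ * r / (k * (∏ j, n j : ℕ)))
    (s := t * (1 - minSamplingRate Ω)) (by positivity)
    (fun i => (Real.le_sqrt (Real.sqrt_nonneg _) (by positivity)).mp (hV i))
    -- `tTranspose` reflects the mode index, hence `-ν`.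
    (fun ν i => (Nat.cast_le.mpr (card_hankel_row_le hkt Ωᶜ X (-ν) i)).trans
      (samplingNumber_compl_le Ω (-ν)))
  rw [← bdiag_tTranspose, ← bdiag_tTranspose, ← bdiag_tTranspose, ← bdiag_tProd, ← bdiag_tProd,
    frobSq_bdiag, frobSq_bdiag, frobSq_bdiag]
  rw [frobTensor_tTranspose] at h2
  have hρ := minSamplingRate_le_one Ω ht
  -- The coefficients are $\mu r(1-\rho)$ and $\mu r(1-\rho)t/k$. As $k\le t$ the second dominates,
  -- which is the source of the factor 2 in the sampling condition.
  have h3 : μ * r / (t * (∏ j, n j : ℕ)) * (t * (1 - minSamplingRate Ω)) * ((∏ j, n j : ℕ) : ℝ) +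
      μ * r / (k * (∏ j, n j : ℕ)) * (t * (1 - minSamplingRate Ω)) * ((∏ j, n j : ℕ) : ℝ) ≤ β := by
    have h4 : μ * r / (t * (∏ j, n j : ℕ)) * (t * (1 - minSamplingRate Ω)) * ((∏ j, n j : ℕ) : ℝ) =
        μ * r * (1 - minSamplingRate Ω) := by field_simp
    have h5 : μ * r / (k * (∏ j, n j : ℕ)) * (t * (1 - minSamplingRate Ω)) * ((∏ j, n j : ℕ) : ℝ) =
        μ * r * (1 - minSamplingRate Ω) * t / k := by field_simp
    have h6 : 0 ≤ μ * r * (1 - minSamplingRate Ω) :=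
      mul_nonneg (by positivity) (by linarith)
    rw [h4, h5, ← le_sub_iff_add_le', div_le_iff₀ hk', sub_mul]
    have := mul_le_mul_of_nonneg_left hkt' h6
    linarith
  rw [← mul_add, mul_left_comm]
  refine mul_le_mul_of_nonneg_left ?_ hN.le
  calc _ ≤ _ := add_le_add h1 h2
    _ = _ := (add_mul _ _ _).symm
    _ ≤ _ := mul_le_mul_of_nonneg_right h3 (sq_nonneg _)

theorem multiRankSum_le {k : ℕ} (Z : Tensor t k n ℝ) :
    multiRankSum Z ≤ (∏ j, n j) * t := by
  have h : ∑ ξ : Modes n, (dft Z ξ).rank ≤ ∑ _ξ : Modes n, t :=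
    Finset.sum_le_sum fun ξ _ => (Matrix.rank_le_card_height _).trans (Fintype.card_fin t).le
  simpa [multiRankSum, Fintype.card_pi, ZMod.card] using h

end Hankel

/-! ### Arithmetic of the final constant. -/

section Constants

/-- Passes from the constant $R+1$ that the argument yields to the stated one. If $R<m$ the second
root alone suffices; if $R=m$ both roots are at least $\sqrt R$ and $2R\ge R+1$. -/
theorem add_one_le_sqrt_add_sqrt_mul_sqrt {R m : ℕ} (hR : R ≤ m) (hm : 1 ≤ m) {α : ℝ}
    (hα : α ≤ 1) : (R : ℝ) + 1 ≤ (√((R : ℝ) + 1 - α) + √((R : ℝ) + 1)) * √(m : ℝ) := by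
  have hmono : √(R : ℝ) ≤ √((R : ℝ) + 1 - α) := Real.sqrt_le_sqrt (by linarith)
  rcases hR.eq_or_lt with h | h
  · subst h
    have h1 : √(R : ℝ) * √(R : ℝ) = R := Real.mul_self_sqrt (Nat.cast_nonneg R)
    have h2 : √(R : ℝ) ≤ √((R : ℝ) + 1) := Real.sqrt_le_sqrt (by linarith)
    have h3 : (1 : ℝ) ≤ R := by exact_mod_cast hm
    have h4 := mul_le_mul_of_nonneg_right (add_le_add hmono h2) (Real.sqrt_nonneg (R : ℝ))
    linarith
  · have h1 : √((R : ℝ) + 1) * √((R : ℝ) + 1) = R + 1 := Real.mul_self_sqrt (by positivity)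
    have h2 : √((R : ℝ) + 1) ≤ √(m : ℝ) := Real.sqrt_le_sqrt (by exact_mod_cast h)
    have h3 := mul_le_mul_of_nonneg_left h2 (Real.sqrt_nonneg ((R : ℝ) + 1))
    have h4 : 0 ≤ √((R : ℝ) + 1 - α) * √(m : ℝ) := by positivity
    linarith

theorem sqrt_mul_lt_sqrt_sub {R α : ℝ} (hR : 0 ≤ R) (hα : α < 1) :
    √(α * R) < √(R + 1 - α) := by
  rcases le_or_gt (α * R) 0 with h | h
  · rw [Real.sqrt_eq_zero'.mpr h]
    exact Real.sqrt_pos.mpr (by linarith)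
  · exact Real.sqrt_lt_sqrt h.le (by nlinarith)

theorem mul_le_of_quadratic_bounds {R α N e d x : ℝ} (hR : 0 ≤ R) (hα₀ : 0 ≤ α) (hα₁ : α ≤ 1)
    (hN : 0 < N) (he : 0 ≤ e) (hd : 0 ≤ d) (hx : 0 ≤ x)
    (h1 : (1 - α / (R + 1)) * (N * e ^ 2) ≤ x ^ 2)
    (h2 : x ≤ √R * √(α / (R + 1) * (N * e ^ 2)) + √(R + 1) * √(N * d ^ 2)) :
    (√(R + 1 - α) - √(α * R)) * e ≤ (R + 1) * d := by
  have hR1 : 0 < R + 1 := by linarith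
  have hs : 0 < √(R + 1) := Real.sqrt_pos.mpr hR1
  have hsN : 0 < √N := Real.sqrt_pos.mpr hN
  have hss : √(R + 1) * √(R + 1) = R + 1 := Real.mul_self_sqrt hR1.le
  have h3 := Real.sqrt_le_sqrt h1
  have h4 : 1 - α / (R + 1) = (R + 1 - α) / (R + 1) := by field_simp
  rw [Real.sqrt_sq hx, h4, Real.sqrt_mul (div_nonneg (by linarith) hR1.le), Real.sqrt_mul hN.le,
    Real.sqrt_sq he, Real.sqrt_div (by linarith)] at h3
  rw [Real.sqrt_mul (div_nonneg hα₀ hR1.le), Real.sqrt_mul hN.le, Real.sqrt_mul hN.le,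
    Real.sqrt_sq he, Real.sqrt_sq hd, Real.sqrt_div hα₀] at h2
  rw [Real.sqrt_mul hα₀]
  -- Multiplying by $\sqrt{R+1}$ clears the denominators; the common factor $\sqrt N$ then cancels.
  have h5 := mul_le_mul_of_nonneg_right (h3.trans h2) hs.le
  have h6 : √(R + 1 - α) / √(R + 1) * (√N * e) * √(R + 1) = √N * (√(R + 1 - α) * e) := by
    field_simp
  have h7 : (√R * (√α / √(R + 1) * (√N * e)) + √(R + 1) * (√N * d)) * √(R + 1) =
      √N * (√α * √R * e + (√(R + 1) * √(R + 1)) * d) := by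
    field_simp
  rw [h6, h7, hss] at h5
  have h8 := le_of_mul_le_mul_left h5 hsN
  linarith

end Constants

/-! ### Assembly of the recovery bound. -/

section Recovery

/-- Stable recovery by the noisy LRTC-TIDT model. -/
theorem frobSeries_solution_sub_le {p : ℕ} (n : Fin p → ℕ) [∀ j, NeZero (n j)] (t k : ℕ)
    (hk : 0 < k) (hkt : k ≤ t)
    (M Y : TimeSeries t n) (Ω : Finset (Fin t × Modes n))
    (μ α δ : ℝ) (hα₀ : 0 < α) (hα₁ : α < 1)
    (r : ℕ) (hr : r = tSVDRank (hankel k M))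
    (rs : ℕ) (hrs : rs = multiRankSum (hankel k M))
    (hM : HankelIncoherent k μ M)
    (hΩ : r ≠ 0 →
      minSamplingRate Ω > 1 - (α * k) / (2 * μ * r * (rs + 1) * t))
    (hY : frobSeries (sample Ω (M - Y)) ≤ δ)
    (Mhat : TimeSeries t n) (hMhat : IsLRTCTIDTSolution k Ω Y δ Mhat) :
    frobSeries (Mhat - M) ≤
      (2 * ((√((rs : ℝ) + 1 - α) + √((rs : ℝ) + 1)) /
              (√((rs : ℝ) + 1 - α) - √(α * rs))) *
          √(((∏ j, n j : ℕ) : ℝ) * t) + 2) * δ := by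
  unfold HankelIncoherent IsSkinnyTSVD at hM
  rw [← hr] at hM
  obtain ⟨hμ, U, S, V, ⟨hUU, hVV, -, hZ⟩, hU, hV⟩ := hM
  have hNpos : 0 < ∏ j, n j := Finset.prod_pos fun j _ => Nat.pos_of_neZero (n j)
  have ht : 0 < t := hk.trans_le hkt
  have ht' : (0 : ℝ) < t := by exact_mod_cast ht
  have hk' : (0 : ℝ) < k := by exact_mod_cast hk
  have hN : (0 : ℝ) < ((∏ j, n j : ℕ) : ℝ) := by exact_mod_cast hNpos
  have hδ : 0 ≤ δ := (frobSeries_nonneg _).trans hY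
  -- The sampling condition cleared of fractions, with $\beta=\alpha/(r_s+1)$; for `r = 0` the left
  -- side vanishes.
  have hβ : 2 * (μ * r * t * (1 - minSamplingRate Ω)) ≤ α / (rs + 1) * k := by
    rcases Nat.eq_zero_or_pos r with h0 | h0
    · rw [h0]; simp; positivity
    · have h1 : 1 - minSamplingRate Ω < (α * k) / (2 * μ * r * (rs + 1) * t) := by
        linarith [hΩ h0.ne']
      have h0' : (0 : ℝ) < r := by exact_mod_cast h0
      rw [lt_div_iff₀ (by positivity)] at h1
      rw [div_mul_eq_mul_div, le_div_iff₀ (by positivity)]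
      linarith
  set N := Mhat - M with hNdef
  set E := bdiag (hankel k (sample Ωᶜ N)) with hE
  set D := bdiag (hankel k (sample Ω N)) with hD
  set A := bdiag (hankel k M) with hA
  have hsum : A + E + D = bdiag (hankel k Mhat) := by
    rw [hA, hE, hD, ← bdiag_add, ← bdiag_add, ← hankel_add, ← hankel_add, add_assoc,
      sample_compl_add_sample, hNdef, add_sub_cancel]
  have hle : nuclearNorm (A + E + D) ≤ nuclearNorm A := by
    rw [hsum]
    exact le_of_mul_le_mul_left (hMhat.2 M hY) (one_div_pos.mpr hN)
  have hUU' : (bdiag U).conjTranspose * bdiag U = 1 := by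
    rw [← bdiag_tTranspose, ← bdiag_tProd, hUU, bdiag_tIdentity]
  have hVV' : (bdiag V).conjTranspose * bdiag V = 1 := by
    rw [← bdiag_tTranspose, ← bdiag_tProd, hVV, bdiag_tIdentity]
  have hAfac : A = bdiag U * (bdiag S * (bdiag V).conjTranspose) := by
    rw [hA, hZ, bdiag_tProd, bdiag_tProd, bdiag_tTranspose, Matrix.mul_assoc]
  obtain ⟨x, hx0, hx1, hx2⟩ := nuclearNorm_perturbation A E D (bdiag U) (bdiag V) hUU' hVV'
    (by rw [hAfac, Matrix.mul_assoc, ← Matrix.mul_assoc _ (bdiag U), hUU', Matrix.one_mul])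
    (by rw [hAfac, Matrix.conjTranspose_mul, Matrix.conjTranspose_mul,
          Matrix.conjTranspose_conjTranspose, Matrix.mul_assoc, Matrix.mul_assoc (bdiag V),
          ← Matrix.mul_assoc _ (bdiag V), hVV', Matrix.one_mul])
    (α / (rs + 1)) (frobSq_hankel_unsampled_le hk hkt hμ.le U V hU hV Ω N hβ) hle
  have hrank : (A.rank : ℝ) ≤ rs := by
    rw [hrs]
    exact_mod_cast rank_blockDiagonal_le _
  have hx3 : x ≤ √(rs : ℝ) * √(α / (rs + 1) * frobSq E) + √((rs : ℝ) + 1) * √(frobSq D) := by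
    refine hx2.trans ?_
    gcongr
  rw [hE, hD, frobSq_bdiag, frobSq_bdiag, frobTensor_hankel hk, frobTensor_hankel hk] at hx3
  rw [hE, frobSq_bdiag, frobTensor_hankel hk] at hx1
  have hbound := mul_le_of_quadratic_bounds (Nat.cast_nonneg rs) hα₀.le hα₁.le hN
    (frobSeries_nonneg _) (frobSeries_nonneg _) hx0 hx1 hx3
  have hd : frobSeries (sample Ω N) ≤ 2 * δ := by
    have h1 : N = (Mhat - Y) - (M - Y) := by rw [hNdef, sub_sub_sub_cancel_right]
    rw [h1, sample_sub]
    linarith [frobSeries_sub_le (sample Ω (Mhat - Y)) (sample Ω (M - Y)), hMhat.1]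
  have hden : 0 < √((rs : ℝ) + 1 - α) - √(α * rs) :=
    sub_pos.mpr (sqrt_mul_lt_sqrt_sub (Nat.cast_nonneg rs) hα₁)
  -- Each of the $n$ face slices has `t` rows, so $r_s\le nt$; this is where $\sqrt{nt}$ enters.
  have hnum : (rs : ℝ) + 1 ≤ (√((rs : ℝ) + 1 - α) + √((rs : ℝ) + 1)) *
      √(((∏ j, n j : ℕ) : ℝ) * t) := by
    rw [← Nat.cast_mul]
    exact add_one_le_sqrt_add_sqrt_mul_sqrt (hrs ▸ multiRankSum_le _) (Nat.mul_pos hNpos ht) hα₁.le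
  have he : frobSeries (sample Ωᶜ N) ≤ ((√((rs : ℝ) + 1 - α) + √((rs : ℝ) + 1)) *
      √(((∏ j, n j : ℕ) : ℝ) * t)) * (2 * δ) / (√((rs : ℝ) + 1 - α) - √(α * rs)) := by
    rw [le_div_iff₀ hden, mul_comm]
    exact hbound.trans (mul_le_mul hnum hd (frobSeries_nonneg _) (by positivity))
  calc frobSeries N = frobSeries (sample Ωᶜ N + sample Ω N) := by rw [sample_compl_add_sample]
    _ ≤ frobSeries (sample Ωᶜ N) + frobSeries (sample Ω N) := frobSeries_add_le _ _
    _ ≤ _ := add_le_add he hd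
    _ = _ := by ring

end Recovery

end TIDT

theorem theorem4p2 {p : ℕ} (n : Fin p → ℕ) [∀ j, NeZero (n j)] (t k : ℕ)
    (hk : 0 < k) (hkt : k ≤ t)
    (M Y : TIDT.TimeSeries t n) (Ω : Finset (Fin t × TIDT.Modes n))
    (μ α δ : ℝ) (hα₀ : 0 < α) (hα₁ : α < 1)
    (r : ℕ) (hr : r = TIDT.tSVDRank (TIDT.hankel k M))
    (rs : ℕ) (hrs : rs = TIDT.multiRankSum (TIDT.hankel k M))
    (hM : TIDT.HankelIncoherent k μ M)
    -- for `r = 0`, i.e. `M = 0`, the fraction is `+∞` and the condition is void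
    (hΩ : r ≠ 0 →
      TIDT.minSamplingRate Ω > 1 - (α * k) / (2 * μ * r * (rs + 1) * t))
    (hY : TIDT.frobSeries (TIDT.sample Ω (M - Y)) ≤ δ)
    (Mhat : TIDT.TimeSeries t n) (hMhat : TIDT.IsLRTCTIDTSolution k Ω Y δ Mhat) :
    TIDT.frobSeries (Mhat - M) ≤
      (2 * ((√((rs : ℝ) + 1 - α) + √((rs : ℝ) + 1)) /
              (√((rs : ℝ) + 1 - α) - √(α * rs))) *
          √(((∏ j, n j : ℕ) : ℝ) * t) + 2) * δ := by
  exact TIDT.frobSeries_solution_sub_le n t k hk hkt M Y Ω μ α δ hα₀ hα₁ r hr rs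
    hrs hM hΩ hY Mhat hMhat
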